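/- Let $q$ be a prime power. For a linear code $C\subseteq\mathbb{F}_{q^2}^n$ let $C^{\perp_H}=\{y : \sum_{i=1}^n x_i y_i^q=0\ \text{for all } x\in C\}$ be its Hermitian dual, and let $A^H_{n,k,\ell,q}$ be the number of linear codes $C\subseteq\mathbb{F}_{q^2}^n$ with $\dim C=k$ and $\dim(C\cap C^{\perp_H})=\ell$. Let $\ell\ge 0$ be an integer and put $a=k-\ell$, $b=n-k-\ell$ (so $k=a+\ell$ and $n=a+b+2\ell$). 1. For fixed $q$, $\ell$ and $a\ge 1$, as $b\to\infty$, $$\frac{A^H_{n,k,\ell,q}}{A^H_{n,k,\ell+1,q}}\longrightarrow \frac{q^{a-1}(q^{\ell+1}+1)(q^{\ell+1}-1)}{q^a-(-1)^a}.$$ 2. For fixed $q$ and $\ell$, as $a,b\to\infty$ jointly, $$\frac{A^H_{n,k,\ell,q}}{A^H_{n,k,\ell+1,q}}\longrightarrow \frac{q^{2(\ell+1)}-1}{q}.$$ 3. Among all integers $\ell\ge 0$, the limit in (2) is smallest at $\ell=0$ and only there; its value there is $(q^2-1)/q=q-q^{-1}>1$. This value equals $3/2$ at $q=2$ and is asymptotically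 equivalent to $q$ as $q\to\infty$. For every prime power $q$ and every $\ell\ge 0$, one has $A^H_{n,k,\ell,q}>A^H_{n,k,\ell+1,q}$ for all sufficiently large $a$ and $b$. -/

import Mathlib

open Filter Topology

/-- In a finite field with `q ^ 2` elements, the map `x ↦ x ^ q` is additive. -/
theorem add_pow_of_card_eq_sq {K : Type*} [Field K] [Finite K] {q : ℕ}
    (hK : Nat.card K = q ^ 2) (x y : K) : (x + y) ^ q = x ^ q + y ^ q := by
  have := Fintype.ofFinite K
  obtain ⟨p, hp⟩ := CharP.exists K
  obtain ⟨n, hpp, hc⟩ := FiniteField.card K p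
  have : Fact p.Prime := ⟨hpp⟩
  have hd : q ∣ p ^ (n : ℕ) := by
    rw [← hc, ← Nat.card_eq_fintype_card, hK]
    exact dvd_pow_self q two_ne_zero
  obtain ⟨m, -, rfl⟩ := (Nat.dvd_prime_pow hpp).1 hd
  exact add_pow_char_pow x y p m

/-- A natural number `q` such that some finite field has `q ^ 2` elements is nonzero. -/
theorem ne_zero_of_card_eq_sq {K : Type*} [Field K] [Finite K] {q : ℕ}
    (hK : Nat.card K = q ^ 2) : q ≠ 0 := by
  rintro rfl
  exact Nat.card_pos.ne' (hK.trans (by norm_num))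

/-- The Hermitian inner product `⟨x, y⟩_H = ∑ i, x i * (y i) ^ q` on `K ^ n`
(used for a field `K` with `q ^ 2` elements). -/
def hermitianInner {K : Type*} [Field K] (q : ℕ) {n : ℕ} (x y : Fin n → K) : K :=
  ∑ i, x i * y i ^ q

/-- The Hermitian dual `{y | ∀ x ∈ C, ⟨x, y⟩_H = 0}` of a linear code `C` of length `n`
over a field `K` with `q ^ 2` elements. -/
def hermitianDual {K : Type*} [Field K] [Finite K] {q : ℕ} (hK : Nat.card K = q ^ 2) {n : ℕ}
    (C : Submodule K (Fin n → K)) : Submodule K (Fin n → K) where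
  carrier := {y | ∀ x ∈ C, hermitianInner q x y = 0}
  zero_mem' := fun x _ => by
    simp [hermitianInner, zero_pow (ne_zero_of_card_eq_sq hK)]
  add_mem' := fun {y z} hy hz x hx => by
    have h1 := hy x hx
    have h2 := hz x hx
    simp only [hermitianInner] at h1 h2 ⊢
    simp only [Pi.add_apply, add_pow_of_card_eq_sq hK, mul_add, Finset.sum_add_distrib,
      h1, h2, add_zero]
  smul_mem' := fun c y hy x hx => by
    have h1 := hy x hx
    simp only [hermitianInner] at h1 ⊢
    simp only [Pi.smul_apply, smul_eq_mul, mul_pow, mul_left_comm _ (c ^ q),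
      ← Finset.mul_sum, h1, mul_zero]

/-- The Hermitian hull `C ∩ C^{⊥_H}` of a linear code `C`. -/
def hermitianHull {K : Type*} [Field K] [Finite K] {q : ℕ} (hK : Nat.card K = q ^ 2) {n : ℕ}
    (C : Submodule K (Fin n → K)) : Submodule K (Fin n → K) :=
  C ⊓ hermitianDual hK C

/-- `A^H_{n,k,ℓ,q}`: the number of `k`-dimensional linear codes of length `n` over a field `K`
with `q ^ 2` elements whose Hermitian hull has dimension `ℓ`. -/
noncomputable def hermitianHullCount {K : Type*} [Field K] [Finite K] {q : ℕ}
    (hK : Nat.card K = q ^ 2) (n k ℓ : ℕ) : ℕ :=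
  Set.ncard {C : Submodule K (Fin n → K) |
    Module.finrank K C = k ∧ Module.finrank K (hermitianHull hK C) = ℓ}

/-!
For the hull dimension `ℓ`, put `n = a + b + 2ℓ` and `k = a + ℓ`, and write `A_ℓ` for the number of
`k`-dimensional codes of length `n` with hull dimension `ℓ`. Both limits come from an exact ratio,
valid for `a, b ≥ 1` (`hermitianHullCount_ratio`):
`A_ℓ / A_{ℓ+1} = q^{a+b-1} (q^{2(ℓ+1)} - 1) / ((q^a - (-1)^a) (q^b - (-1)^b))`,
in which `q^m / (q^m - (-1)^m)` tends to `1`.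

The ratio is obtained without closed formulas for `A_ℓ`, by comparing `A_ℓ` and `A_{ℓ+1}` with the
number of `(k - 1)`-dimensional codes `E` of hull dimension `ℓ`. Adding to `E` a vector `v` of its
Hermitian dual leaves the hull unchanged if `v` is anisotropic, and enlarges it by `v` if `v` is
isotropic. Counting the pairs `(E, v)` in the first case (`hermitianHullCount_mul_eq`), and the pairs
together with a vector that marks a complement of `v` in the second
(`hermitianHullCount_mul_eq_succ`), gives two linear relations, whose quotient is the ratio. They
also show that the counts are positive (`hermitianHullCount_pos`), so that no quotient is degenerate.

The relations need the number of isotropic vectors of a code of dimension `d` and hull dimension `r`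
(`mul_ncard_isotropic`). Splitting off an anisotropic vector lowers `d` and keeps `r`; since the norm
`x ↦ x^{q+1}` takes each nonzero value in its image exactly `q + 1` times (`ncard_norm_fiber`), this
gives a recursion in `d`, which stops at a totally isotropic code.
-/

/-! ### The field with `q ^ 2` elements -/

section Field

variable {K : Type*} [Field K] [Finite K] {q : ℕ}

theorem two_le_of_card_eq_sq (hK : Nat.card K = q ^ 2) : 2 ≤ q := by
  have h : 1 < q ^ 2 := hK ▸ Finite.one_lt_card
  by_contra hq
  interval_cases q <;> simp at h

theorem pow_pow_of_card_eq_sq (hK : Nat.card K = q ^ 2) (x : K) : (x ^ q) ^ q = x := by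
  have := Fintype.ofFinite K
  rw [← pow_mul, ← sq, ← hK, Nat.card_eq_fintype_card, FiniteField.pow_card]

theorem sum_pow_of_card_eq_sq (hK : Nat.card K = q ^ 2) {ι : Type*} (s : Finset ι) (f : ι → K) :
    (∑ i ∈ s, f i) ^ q = ∑ i ∈ s, f i ^ q := by
  let φ : K →+ K :=
    { toFun := fun x => x ^ q
      map_zero' := zero_pow (ne_zero_of_card_eq_sq hK)
      map_add' := add_pow_of_card_eq_sq hK }
  exact map_sum φ f s

theorem neg_pow_of_card_eq_sq (hK : Nat.card K = q ^ 2) (x : K) : (-x) ^ q = -x ^ q := by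
  have h := add_pow_of_card_eq_sq hK (-x) x
  rw [neg_add_cancel, zero_pow (ne_zero_of_card_eq_sq hK)] at h
  exact eq_neg_of_add_eq_zero_left h.symm

theorem pow_injective_of_card_eq_sq (hK : Nat.card K = q ^ 2) :
    Function.Injective fun x : K => x ^ q := fun x y h => by
  rw [← pow_pow_of_card_eq_sq hK x, ← pow_pow_of_card_eq_sq hK y]
  exact congrArg (· ^ q) h

/-- The Frobenius `x ↦ x ^ q` is not the identity, since `X ^ q - X` has at most `q` roots. -/
theorem exists_pow_ne_self (hK : Nat.card K = q ^ 2) : ∃ x : K, x ^ q ≠ x := by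
  classical
  have := Fintype.ofFinite K
  have hq := two_le_of_card_eq_sq hK
  by_contra! h
  have hne := FiniteField.X_pow_card_sub_X_ne_zero K (p := q) (by omega)
  have hle := (Polynomial.card_roots' (Polynomial.X ^ q - Polynomial.X : Polynomial K))
  rw [FiniteField.X_pow_card_sub_X_natDegree_eq K (by omega)] at hle
  have hsub : (Finset.univ : Finset K) ⊆
      (Polynomial.X ^ q - Polynomial.X : Polynomial K).roots.toFinset := fun x _ => by
    simp [hne, h x]
  have hc := (Finset.card_le_card hsub).trans (Multiset.toFinset_card_le _)
  rw [Finset.card_univ, ← Nat.card_eq_fintype_card, hK] at hc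
  nlinarith

/-- The norm `x ↦ x ^ (q + 1)` maps the cyclic group `Kˣ`, of order `(q - 1) (q + 1)`, onto the
elements `c ≠ 0` with `c ^ q = c`, and all its fibres have `q + 1` elements. -/
theorem ncard_norm_fiber (hK : Nat.card K = q ^ 2) {c : K} (hc : c ≠ 0) (hcq : c ^ q = c) :
    {x : K | x ^ (q + 1) = c}.ncard = q + 1 := by
  have hq := two_le_of_card_eq_sq hK
  have hU : Nat.card Kˣ = (q - 1) * (q + 1) := by
    have := Fintype.ofFinite K
    rw [Nat.card_units, hK]
    obtain ⟨m, rfl⟩ : ∃ m, q = m + 1 := ⟨q - 1, by omega⟩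
    simp only [Nat.add_sub_cancel]
    rw [Nat.sub_eq_iff_eq_add (by nlinarith)]; ring
  have hker : Nat.card (powMonoidHom (q + 1) : Kˣ →* Kˣ).ker = q + 1 := by
    rw [IsCyclic.card_powMonoidHom_ker, hU, Nat.gcd_mul_left_left]
  have hrange : (powMonoidHom (q + 1) : Kˣ →* Kˣ).range
      = (powMonoidHom (q - 1) : Kˣ →* Kˣ).ker := by
    apply Subgroup.eq_of_le_of_card_ge
    · rintro _ ⟨x, rfl⟩
      rw [MonoidHom.mem_ker, powMonoidHom_apply, powMonoidHom_apply, ← pow_mul, mul_comm, ← hU,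
        pow_card_eq_one']
    · rw [IsCyclic.card_powMonoidHom_ker, IsCyclic.card_powMonoidHom_range, hU,
        Nat.gcd_mul_right_left, Nat.gcd_mul_left_left, Nat.mul_div_cancel _ (by omega)]
  have hmem : Units.mk0 c hc ∈ (powMonoidHom (q + 1) : Kˣ →* Kˣ).range := by
    rw [hrange, MonoidHom.mem_ker, powMonoidHom_apply]
    ext
    have : c ^ (q - 1) * c = 1 * c := by
      rw [← pow_succ, Nat.sub_add_cancel (by omega), hcq, one_mul]
    simpa using mul_right_cancel₀ hc this
  obtain ⟨y, hy⟩ := hmem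
  have hy' : (y : K) ^ (q + 1) = c := by simpa using congrArg Units.val hy
  rw [← Nat.card_coe_set_eq]
  refine (Nat.card_congr (Equiv.ofBijective
    (fun x : (powMonoidHom (q + 1) : Kˣ →* Kˣ).ker =>
      (⟨(x : Kˣ) * y, ?_⟩ : {x : K | x ^ (q + 1) = c})) ⟨?_, ?_⟩)).symm.trans hker
  · have hx := congrArg Units.val (MonoidHom.mem_ker.1 x.2)
    simp only [powMonoidHom_apply, Units.val_pow_eq_pow_val, Units.val_one] at hx
    rw [Set.mem_ofPred_eq, mul_pow, hx, hy', one_mul]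
  · intro x x' h
    have := congrArg Subtype.val h
    ext
    exact mul_right_cancel₀ y.ne_zero this
  · rintro ⟨x, hx⟩
    have hx' : x ^ (q + 1) = c := hx
    have hx0 : x ≠ 0 := by
      rintro rfl
      exact hc (by simpa using hx'.symm)
    refine ⟨⟨Units.mk0 x hx0 * y⁻¹, ?_⟩, ?_⟩
    · rw [MonoidHom.mem_ker, powMonoidHom_apply]
      ext
      simp [mul_pow, hx', hy', hc]
    · simp
end Field

/-! ### The Hermitian form -/

section Form

variable {K : Type*} [Field K] {q n : ℕ}

theorem hermitianInner_add_left (x y z : Fin n → K) :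
    hermitianInner q (x + y) z = hermitianInner q x z + hermitianInner q y z := by
  simp [hermitianInner, add_mul, Finset.sum_add_distrib]

theorem hermitianInner_smul_left (c : K) (x y : Fin n → K) :
    hermitianInner q (c • x) y = c * hermitianInner q x y := by
  simp [hermitianInner, Finset.mul_sum, mul_assoc]

theorem hermitianInner_neg_left (x y : Fin n → K) :
    hermitianInner q (-x) y = -hermitianInner q x y := by
  simp [hermitianInner]

theorem hermitianInner_sub_left (x y z : Fin n → K) :
    hermitianInner q (x - y) z = hermitianInner q x z - hermitianInner q y z := by
  rw [sub_eq_add_neg, hermitianInner_add_left, hermitianInner_neg_left, sub_eq_add_neg]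

theorem hermitianInner_smul_right (c : K) (x y : Fin n → K) :
    hermitianInner q x (c • y) = c ^ q * hermitianInner q x y := by
  simp [hermitianInner, Finset.mul_sum, mul_pow, mul_left_comm]

theorem hermitianInner_zero_left (x : Fin n → K) : hermitianInner q 0 x = 0 := by
  simp [hermitianInner]

theorem finrank_sup_span {E : Submodule K (Fin n → K)} {v : Fin n → K} (hv : v ∉ E) :
    Module.finrank K (E ⊔ K ∙ v : Submodule K (Fin n → K)) = Module.finrank K E + 1 := by
  have hv0 : v ≠ 0 := by
    rintro rfl
    exact hv E.zero_mem
  have h := Submodule.finrank_sup_add_finrank_inf_eq E (K ∙ v)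
  rwa [((Submodule.disjoint_span_singleton' hv0).2 hv).eq_bot, finrank_bot, add_zero,
    finrank_span_singleton hv0] at h

variable [Finite K]

theorem hermitianInner_pow (hK : Nat.card K = q ^ 2) (x y : Fin n → K) :
    hermitianInner q x y ^ q = hermitianInner q y x := by
  simp only [hermitianInner, sum_pow_of_card_eq_sq hK, mul_pow, pow_pow_of_card_eq_sq hK]
  exact Finset.sum_congr rfl fun i _ => mul_comm _ _

theorem hermitianInner_eq_zero_comm (hK : Nat.card K = q ^ 2) {x y : Fin n → K} :
    hermitianInner q x y = 0 ↔ hermitianInner q y x = 0 := by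
  rw [← hermitianInner_pow hK x y, pow_eq_zero_iff (ne_zero_of_card_eq_sq hK)]

theorem hermitianInner_add_right (hK : Nat.card K = q ^ 2) (x y z : Fin n → K) :
    hermitianInner q x (y + z) = hermitianInner q x y + hermitianInner q x z := by
  simp [hermitianInner, add_pow_of_card_eq_sq hK, mul_add, Finset.sum_add_distrib]

theorem mem_hermitianDual (hK : Nat.card K = q ^ 2) {C : Submodule K (Fin n → K)}
    {y : Fin n → K} : y ∈ hermitianDual hK C ↔ ∀ x ∈ C, hermitianInner q x y = 0 :=
  Iff.rfl

theorem mem_hermitianDual' (hK : Nat.card K = q ^ 2) {C : Submodule K (Fin n → K)}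
    {y : Fin n → K} : y ∈ hermitianDual hK C ↔ ∀ x ∈ C, hermitianInner q y x = 0 := by
  simp_rw [mem_hermitianDual, hermitianInner_eq_zero_comm hK (y := y)]

theorem mem_hermitianDual_span (hK : Nat.card K = q ^ 2) {v x : Fin n → K} :
    x ∈ hermitianDual hK (K ∙ v) ↔ hermitianInner q x v = 0 := by
  rw [mem_hermitianDual']
  refine ⟨fun h => h v (Submodule.mem_span_singleton_self v), fun h y hy => ?_⟩
  obtain ⟨c, rfl⟩ := Submodule.mem_span_singleton.1 hy
  rw [hermitianInner_smul_right, h, mul_zero]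

theorem le_hermitianDual_comm (hK : Nat.card K = q ^ 2) {C D : Submodule K (Fin n → K)} :
    C ≤ hermitianDual hK D ↔ D ≤ hermitianDual hK C :=
  ⟨fun h _ hx => (mem_hermitianDual' hK).2 fun _ hy => h hy _ hx,
   fun h _ hx => (mem_hermitianDual' hK).2 fun _ hy => h hy _ hx⟩

theorem hermitianDual_sup (hK : Nat.card K = q ^ 2) (C D : Submodule K (Fin n → K)) :
    hermitianDual hK (C ⊔ D) = hermitianDual hK C ⊓ hermitianDual hK D := by
  refine eq_of_forall_le_iff fun X => ?_
  rw [le_inf_iff, le_hermitianDual_comm hK, sup_le_iff, le_hermitianDual_comm hK (C := C),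
    le_hermitianDual_comm hK (C := D)]

theorem le_hermitianDual_span (hK : Nat.card K = q ^ 2) {C : Submodule K (Fin n → K)}
    {v : Fin n → K} : C ≤ hermitianDual hK (K ∙ v) ↔ v ∈ hermitianDual hK C := by
  rw [le_hermitianDual_comm hK, Submodule.span_singleton_le_iff_mem]

/-- The semilinear bijection `w ↦ ⟨·, w⟩_H` onto the dual space carries the Hermitian dual of `C`
to the annihilator of `C`. -/
theorem natCard_hermitianDual (hK : Nat.card K = q ^ 2) (C : Submodule K (Fin n → K)) :
    Nat.card (hermitianDual hK C) = Nat.card C.dualAnnihilator := by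
  let φ : (Fin n → K) → Module.Dual K (Fin n → K) := fun w =>
    { toFun := fun x => hermitianInner q x w
      map_add' := fun x y => hermitianInner_add_left x y w
      map_smul' := fun c x => hermitianInner_smul_left c x w }
  have hinj : Function.Injective φ := fun w w' h => by
    funext i
    have := congrArg (fun f : Module.Dual K (Fin n → K) => f (Pi.single i 1)) h
    refine pow_injective_of_card_eq_sq hK ?_
    simpa [φ, hermitianInner, Pi.single_apply] using this
  have hcard : Nat.card (Fin n → K) = Nat.card (Module.Dual K (Fin n → K)) := by
    rw [Module.natCard_eq_pow_finrank (K := K) (V := Fin n → K),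
      Module.natCard_eq_pow_finrank (K := K) (V := Module.Dual K (Fin n → K)),
      Subspace.dual_finrank_eq]
  have hfin : Finite (Module.Dual K (Fin n → K)) := Module.finite_of_finite K
  have hbij : Function.Bijective φ :=
    (Nat.bijective_iff_injective_and_card φ).2 ⟨hinj, hcard⟩
  refine Nat.card_congr ((Equiv.ofBijective φ hbij).subtypeEquiv fun w => ?_)
  rw [Submodule.mem_dualAnnihilator]
  exact Iff.rfl

theorem finrank_add_finrank_hermitianDual (hK : Nat.card K = q ^ 2)
    (C : Submodule K (Fin n → K)) :
    Module.finrank K C + Module.finrank K (hermitianDual hK C) = n := by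
  have h := natCard_hermitianDual hK C
  rw [Module.natCard_eq_pow_finrank (K := K) (V := hermitianDual hK C),
    Module.natCard_eq_pow_finrank (K := K) (V := C.dualAnnihilator)] at h
  have h' := Nat.pow_right_injective (Finite.one_lt_card (α := K)) h
  rw [h',
    Subspace.finrank_add_finrank_dualAnnihilator_eq, Module.finrank_fin_fun]

theorem hermitianDual_hermitianDual (hK : Nat.card K = q ^ 2) (C : Submodule K (Fin n → K)) :
    hermitianDual hK (hermitianDual hK C) = C := by
  refine (Submodule.eq_of_le_of_finrank_eq ((le_hermitianDual_comm hK).1 le_rfl) ?_).symm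
  have h1 := finrank_add_finrank_hermitianDual hK C
  have h2 := finrank_add_finrank_hermitianDual hK (hermitianDual hK C)
  omega

theorem hermitianHull_hermitianDual (hK : Nat.card K = q ^ 2) (C : Submodule K (Fin n → K)) :
    hermitianHull hK (hermitianDual hK C) = hermitianHull hK C := by
  rw [hermitianHull, hermitianHull, hermitianDual_hermitianDual, inf_comm]

/-- Polarization: a code all of whose vectors are isotropic is contained in its Hermitian dual.
The scalar `c` with `c ^ q ≠ c` replaces division by `2`. -/
theorem le_hermitianDual_self (hK : Nat.card K = q ^ 2) {C : Submodule K (Fin n → K)}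
    (h : ∀ v ∈ C, hermitianInner q v v = 0) : C ≤ hermitianDual hK C := by
  intro y hy x hx
  obtain ⟨c, hc⟩ := exists_pow_ne_self hK
  have key : ∀ x ∈ C, hermitianInner q x y + hermitianInner q y x = 0 := fun x hx => by
    have := h _ (C.add_mem hx hy)
    simpa [hermitianInner_add_left, hermitianInner_add_right hK, h x hx, h y hy, add_comm] using this
  have h1 := key x hx
  have h2 := key _ (C.smul_mem c hx)
  rw [hermitianInner_smul_left, hermitianInner_smul_right] at h2
  have h3 : (c ^ q - c) * hermitianInner q x y = 0 := by linear_combination c ^ q * h1 - h2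
  exact (mul_eq_zero.1 h3).resolve_left (sub_ne_zero.2 hc)

/-! ### Splitting off a vector -/

theorem sup_span_inf_hermitianDual_span (hK : Nat.card K = q ^ 2) {E : Submodule K (Fin n → K)}
    {v w : Fin n → K} (hw : w ∈ hermitianDual hK E) (hvw : hermitianInner q v w ≠ 0) :
    (E ⊔ K ∙ v) ⊓ hermitianDual hK (K ∙ w) = E := by
  refine le_antisymm ?_ (le_inf le_sup_left ((le_hermitianDual_span hK).2 hw))
  rintro x ⟨hx, hxw⟩
  obtain ⟨e, he, y, hy, rfl⟩ := Submodule.mem_sup.1 hx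
  obtain ⟨c, rfl⟩ := Submodule.mem_span_singleton.1 hy
  have := (mem_hermitianDual_span hK).1 hxw
  rw [hermitianInner_add_left, hw e he, zero_add, hermitianInner_smul_left] at this
  rw [(mul_eq_zero.1 this).resolve_right hvw, zero_smul, add_zero]
  exact he

theorem inf_hermitianDual_span_sup_span (hK : Nat.card K = q ^ 2) {C : Submodule K (Fin n → K)}
    {v w : Fin n → K} (hv : v ∈ C) (hvw : hermitianInner q v w ≠ 0) :
    (C ⊓ hermitianDual hK (K ∙ w)) ⊔ K ∙ v = C := by
  refine le_antisymm (sup_le inf_le_left ((Submodule.span_singleton_le_iff_mem _ _).2 hv)) ?_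
  intro x hx
  set c := hermitianInner q x w / hermitianInner q v w
  rw [← sub_add_cancel x (c • v)]
  refine Submodule.add_mem_sup ⟨C.sub_mem hx (C.smul_mem c hv), ?_⟩
    (Submodule.smul_mem _ _ (Submodule.mem_span_singleton_self v))
  refine (mem_hermitianDual_span hK).2 ?_
  rw [hermitianInner_sub_left, hermitianInner_smul_left, div_mul_cancel₀ _ hvw, sub_self]

theorem notMem_of_hermitianInner_ne_zero (hK : Nat.card K = q ^ 2)
    {E : Submodule K (Fin n → K)} {v w : Fin n → K} (hw : w ∈ hermitianDual hK E)
    (hvw : hermitianInner q v w ≠ 0) : v ∉ E :=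
  fun hv => hvw (hw v hv)

/-- Adding an anisotropic vector orthogonal to a code does not change its hull. -/
theorem hermitianHull_sup_span_of_anisotropic (hK : Nat.card K = q ^ 2)
    {E : Submodule K (Fin n → K)} {v : Fin n → K} (hv : v ∈ hermitianDual hK E)
    (hvv : hermitianInner q v v ≠ 0) :
    hermitianHull hK (E ⊔ K ∙ v) = hermitianHull hK E := by
  rw [hermitianHull, hermitianHull, hermitianDual_sup, inf_comm (hermitianDual hK E),
    ← inf_assoc, sup_span_inf_hermitianDual_span hK hv hvv]

/-- Adding an isotropic vector orthogonal to a code adds it to its hull. -/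
theorem hermitianHull_sup_span_of_isotropic (hK : Nat.card K = q ^ 2)
    {E : Submodule K (Fin n → K)} {v : Fin n → K} (hv : v ∈ hermitianDual hK E)
    (hvv : hermitianInner q v v = 0) :
    hermitianHull hK (E ⊔ K ∙ v) = hermitianHull hK E ⊔ K ∙ v := by
  have h1 : K ∙ v ≤ hermitianDual hK (K ∙ v) := by
    rwa [Submodule.span_singleton_le_iff_mem, mem_hermitianDual_span]
  have h2 : K ∙ v ≤ hermitianDual hK E := by rwa [Submodule.span_singleton_le_iff_mem]
  have h3 : E ⊔ K ∙ v ≤ hermitianDual hK (K ∙ v) := sup_le ((le_hermitianDual_span hK).2 hv) h1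
  rw [hermitianHull, hermitianHull, hermitianDual_sup, inf_comm (hermitianDual hK E),
    ← inf_assoc, inf_eq_left.2 h3, inf_comm, ← inf_sup_assoc_of_le _ h2, inf_comm]

end Form

/-! ### Counting isotropic vectors -/

section Counting

/-- Double counting with constant weighted fibres: the weight `c` makes it possible to state fibre
sizes without division. -/
theorem mul_ncard_pairs {α β : Type*} [Finite α] [Finite β] {P : Set α} {S : α → Set β} {c M : ℤ}
    (h : ∀ a ∈ P, c * ((S a).ncard : ℤ) = M) :
    c * ({p : α × β | p.1 ∈ P ∧ p.2 ∈ S p.1}.ncard : ℤ) = (P.ncard : ℤ) * M := by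
  classical
  have := Fintype.ofFinite α
  have := Fintype.ofFinite β
  have h1 : {p : α × β | p.1 ∈ P ∧ p.2 ∈ S p.1}.ncard
      = ∑ a ∈ P.toFinset, (S a).ncard := by
    rw [Set.ncard_eq_toFinset_card',
      Finset.card_eq_sum_card_fiberwise (f := Prod.fst) (t := P.toFinset)]
    · refine Finset.sum_congr rfl fun a ha => ?_
      rw [Set.mem_toFinset] at ha
      rw [Set.ncard_eq_toFinset_card' (S a),
        ← Finset.card_image_of_injective (S a).toFinset (Prod.mk_right_injective a)]
      refine congrArg Finset.card ?_
      ext ⟨x, y⟩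
      simp only [Finset.mem_filter, Set.mem_toFinset, Set.mem_ofPred_eq, Finset.mem_image,
        Prod.mk.injEq]
      constructor
      · rintro ⟨⟨_, hy⟩, rfl⟩
        exact ⟨y, hy, rfl, rfl⟩
      · rintro ⟨y, hy, rfl, rfl⟩
        exact ⟨⟨ha, hy⟩, rfl⟩
    · intro p hp
      simp only [Set.mem_ofPred_eq, Set.coe_toFinset] at hp ⊢
      exact hp.1
  rw [h1, Nat.cast_sum, Finset.mul_sum, Finset.sum_congr rfl fun a ha =>
    h a (Set.mem_toFinset.1 ha), Finset.sum_const, nsmul_eq_mul, Set.ncard_eq_toFinset_card']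

theorem ncard_sep_add_ncard_sep_not {α : Type*} [Finite α] (s : Set α) (p : α → Prop) :
    {x | x ∈ s ∧ p x}.ncard + {x | x ∈ s ∧ ¬ p x}.ncard = s.ncard := by
  rw [← Set.ncard_inter_add_ncard_sdiff_eq_ncard s {x | p x}]
  rfl

variable {K : Type*} [Field K] {q n : ℕ}

theorem ncard_submodule (hK : Nat.card K = q ^ 2) (W : Submodule K (Fin n → K)) :
    ((W : Set (Fin n → K)).ncard : ℤ) = (q : ℤ) ^ (2 * Module.finrank K W) := by
  rw [← Nat.card_coe_set_eq]
  change ((Nat.card W : ℕ) : ℤ) = _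
  rw [Module.natCard_eq_pow_finrank (K := K) (V := W), hK, pow_mul]
  push_cast
  rfl

variable [Finite K]

/-- If `v` is anisotropic and orthogonal to `E`, then the isotropic vectors of `E ⊔ ⟨v⟩` correspond
to the pairs `(e, x)` with `e ∈ E` and `x ^ (q + 1) ⟨v, v⟩_H = -⟨e, e⟩_H`. There is one such `x` for
each isotropic `e` and there are `q + 1` for each other `e`. -/
theorem ncard_isotropic_sup_span (hK : Nat.card K = q ^ 2) {E : Submodule K (Fin n → K)}
    {v : Fin n → K} (hv : v ∈ hermitianDual hK E) (hvv : hermitianInner q v v ≠ 0) :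
    ({x | x ∈ E ⊔ K ∙ v ∧ hermitianInner q x x = 0}.ncard : ℤ) =
      (q + 1) * (q : ℤ) ^ (2 * Module.finrank K E)
        - q * {x | x ∈ E ∧ hermitianInner q x x = 0}.ncard := by
  set S : (Fin n → K) → Set K := fun e =>
    {x | hermitianInner q e e + x ^ (q + 1) * hermitianInner q v v = 0}
  have hS0 : ∀ e ∈ {x | x ∈ E ∧ hermitianInner q x x = 0}, 1 * ((S e).ncard : ℤ) = 1 := by
    rintro e ⟨_, he⟩
    have : S e = {0} := by
      ext x
      simp [S, he, hvv]
    simp [this]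
  have hS1 : ∀ e ∈ {x | x ∈ E ∧ ¬ hermitianInner q x x = 0},
      1 * ((S e).ncard : ℤ) = q + 1 := by
    rintro e ⟨_, he⟩
    have : S e = {x | x ^ (q + 1) = -hermitianInner q e e / hermitianInner q v v} := by
      ext x
      simp only [S, Set.mem_ofPred_eq]
      rw [eq_div_iff hvv, add_comm, add_eq_zero_iff_eq_neg]
    rw [this, ncard_norm_fiber hK (div_ne_zero (neg_ne_zero.2 he) hvv)]
    · push_cast
      ring
    · rw [div_pow, neg_pow_of_card_eq_sq hK, hermitianInner_pow hK, hermitianInner_pow hK]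
  have h0 := mul_ncard_pairs hS0
  have h1 := mul_ncard_pairs hS1
  have hE := ncard_sep_add_ncard_sep_not (E : Set (Fin n → K)) fun x => hermitianInner q x x = 0
  have hp := ncard_sep_add_ncard_sep_not
    {p : (Fin n → K) × K | p.1 ∈ E ∧ p.2 ∈ S p.1} fun p => hermitianInner q p.1 p.1 = 0
  have hb : {p : (Fin n → K) × K | p.1 ∈ E ∧ p.2 ∈ S p.1}.ncard =
      {x | x ∈ E ⊔ K ∙ v ∧ hermitianInner q x x = 0}.ncard := by
    have hval : ∀ e ∈ E, ∀ x : K, hermitianInner q (e + x • v) (e + x • v) =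
        hermitianInner q e e + x ^ (q + 1) * hermitianInner q v v := fun e he x => by
      have h2 : hermitianInner q e v = 0 := hv e he
      have h3 : hermitianInner q v e = 0 := (hermitianInner_eq_zero_comm hK).1 h2
      simp only [hermitianInner_add_left, hermitianInner_add_right hK, hermitianInner_smul_left,
        hermitianInner_smul_right, h2, h3]
      ring
    refine Set.ncard_congr (fun p _ => p.1 + p.2 • v) ?_ ?_ ?_
    · rintro ⟨e, x⟩ ⟨he, hx⟩
      exact ⟨Submodule.add_mem_sup he (Submodule.smul_mem _ _
        (Submodule.mem_span_singleton_self v)), (hval e he x).trans hx⟩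
    · rintro ⟨e, x⟩ ⟨e', x'⟩ ⟨he, -⟩ ⟨he', -⟩ h
      have h2 := congrArg (hermitianInner q · v) h
      simp only [hermitianInner_add_left, hermitianInner_smul_left, hv e he, hv e' he',
        zero_add] at h2
      obtain rfl := mul_right_cancel₀ hvv h2
      exact Prod.ext (add_right_cancel h) rfl
    · rintro y ⟨hy, hyy⟩
      obtain ⟨e, he, z, hz, rfl⟩ := Submodule.mem_sup.1 hy
      obtain ⟨x, rfl⟩ := Submodule.mem_span_singleton.1 hz
      exact ⟨(e, x), ⟨he, (hval e he x).symm.trans hyy⟩, rfl⟩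
  rw [← hb, ← hp]
  have e0 : {p : (Fin n → K) × K | p ∈ {p : (Fin n → K) × K | p.1 ∈ E ∧ p.2 ∈ S p.1} ∧
      hermitianInner q p.1 p.1 = 0} = {p : (Fin n → K) × K |
        p.1 ∈ {x | x ∈ E ∧ hermitianInner q x x = 0} ∧ p.2 ∈ S p.1} := by
    ext p
    exact and_right_comm
  have e1 : {p : (Fin n → K) × K | p ∈ {p : (Fin n → K) × K | p.1 ∈ E ∧ p.2 ∈ S p.1} ∧
      ¬ hermitianInner q p.1 p.1 = 0} = {p : (Fin n → K) × K |
        p.1 ∈ {x | x ∈ E ∧ ¬ hermitianInner q x x = 0} ∧ p.2 ∈ S p.1} := by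
    ext p
    exact and_right_comm
  rw [e0, e1]
  have hE' := congrArg (Nat.cast (R := ℤ)) hE
  rw [Nat.cast_add, ncard_submodule hK] at hE'
  simp only [SetLike.mem_coe] at hE'
  push_cast
  linear_combination h0 + h1 + ((q : ℤ) + 1) * hE'

/-- The number of isotropic vectors of a code of dimension `d` whose hull has dimension `r`. -/
theorem mul_ncard_isotropic (hK : Nat.card K = q ^ 2) (W : Submodule K (Fin n → K)) {d r : ℕ}
    (hd : Module.finrank K W = d) (hr : Module.finrank K (hermitianHull hK W) = r) :
    (q : ℤ) * {x | x ∈ W ∧ hermitianInner q x x = 0}.ncard =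
      (q : ℤ) ^ (2 * d) + (-1) ^ (d + r) * (q : ℤ) ^ (d + r) * (q - 1) := by
  induction d generalizing W with
  | zero =>
    rw [Submodule.finrank_eq_zero] at hd
    subst hd
    have h0 : hermitianHull hK (⊥ : Submodule K (Fin n → K)) = ⊥ := bot_inf_eq _
    rw [h0, finrank_bot] at hr
    subst hr
    have : {x : Fin n → K | x ∈ (⊥ : Submodule K (Fin n → K)) ∧ hermitianInner q x x = 0}
        = {0} := by
      ext x
      simp only [Submodule.mem_bot, Set.mem_ofPred_eq, Set.mem_singleton_iff, and_iff_left_iff_imp]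
      rintro rfl
      exact hermitianInner_zero_left 0
    rw [this, Set.ncard_singleton]
    push_cast
    ring
  | succ d ih =>
    by_cases h : ∀ v ∈ W, hermitianInner q v v = 0
    · have h1 : hermitianHull hK W = W := inf_eq_left.2 (le_hermitianDual_self hK h)
      rw [h1, hd] at hr
      subst hr
      have h2 : {x | x ∈ W ∧ hermitianInner q x x = 0} = (W : Set (Fin n → K)) := by
        ext x
        exact and_iff_left_of_imp (h x)
      rw [h2, ncard_submodule hK, hd, ← two_mul, (even_two_mul _).neg_one_pow]
      ring
    · push Not at h
      obtain ⟨v, hv, hvv⟩ := h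
      set E := W ⊓ hermitianDual hK (K ∙ v)
      have hvE : v ∈ hermitianDual hK E := (le_hermitianDual_span hK).1 inf_le_right
      have hW : E ⊔ K ∙ v = W := inf_hermitianDual_span_sup_span hK hv hvv
      have hdE := finrank_sup_span (notMem_of_hermitianInner_ne_zero hK hvE hvv)
      rw [hW, hd] at hdE
      have hdE' : Module.finrank K E = d := by omega
      have hrE := hermitianHull_sup_span_of_anisotropic hK hvE hvv
      rw [hW] at hrE
      have h1 := ncard_isotropic_sup_span hK hvE hvv
      rw [hW, hdE'] at h1
      rw [h1, mul_sub, ih E hdE' (hrE ▸ hr)]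
      ring

end Counting

/-! ### Recursions for the numbers of codes -/

section Recursion

variable {K : Type*} [Field K] [Finite K] {q n : ℕ}

/-- The number of anisotropic vectors of a code of dimension `d` whose hull has dimension `r`. -/
theorem mul_ncard_anisotropic (hK : Nat.card K = q ^ 2) (W : Submodule K (Fin n → K)) {d r : ℕ}
    (hd : Module.finrank K W = d) (hr : Module.finrank K (hermitianHull hK W) = r) :
    (q : ℤ) * {x | x ∈ W ∧ ¬ hermitianInner q x x = 0}.ncard =
      (q - 1) * ((q : ℤ) ^ (2 * d) - (-1) ^ (d + r) * (q : ℤ) ^ (d + r)) := by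
  have h1 := mul_ncard_isotropic hK W hd hr
  have h2 := congrArg (Nat.cast (R := ℤ))
    (ncard_sep_add_ncard_sep_not (W : Set (Fin n → K)) fun x => hermitianInner q x x = 0)
  rw [Nat.cast_add, ncard_submodule hK, hd] at h2
  simp only [SetLike.mem_coe] at h2
  linear_combination (q : ℤ) * h2 - h1

/-- The number of isotropic vectors outside `E` that are orthogonal to `E`. -/
theorem mul_ncard_isotropic_notMem (hK : Nat.card K = q ^ 2) (E : Submodule K (Fin n → K))
    {m r : ℕ} (hm : Module.finrank K (hermitianDual hK E) = m)
    (hr : Module.finrank K (hermitianHull hK E) = r) :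
    (q : ℤ) * {x | (x ∈ hermitianDual hK E ∧ hermitianInner q x x = 0) ∧ ¬ x ∈ E}.ncard =
      (q : ℤ) ^ (2 * m) + (-1) ^ (m + r) * (q : ℤ) ^ (m + r) * (q - 1) - q * q ^ (2 * r) := by
  have h1 := mul_ncard_isotropic hK _ hm (by rw [hermitianHull_hermitianDual, hr])
  have h2 := congrArg (Nat.cast (R := ℤ))
    (ncard_sep_add_ncard_sep_not
      {x | x ∈ hermitianDual hK E ∧ hermitianInner q x x = 0} fun x => x ∈ E)
  have h3 : {x | x ∈ {x | x ∈ hermitianDual hK E ∧ hermitianInner q x x = 0} ∧ x ∈ E} =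
      (hermitianHull hK E : Set (Fin n → K)) := by
    ext x
    exact ⟨fun h => ⟨h.2, h.1.1⟩, fun h => ⟨⟨h.2, h.2 x h.1⟩, h.1⟩⟩
  rw [Nat.cast_add, h3, ncard_submodule hK, hr] at h2
  simp only [Set.mem_ofPred_eq] at h2
  linear_combination (q : ℤ) * h2 + h1

/-- For `v ∉ E`, the vectors `w` orthogonal to `E` with `⟨v, w⟩_H ≠ 0` are those outside a
hyperplane of the Hermitian dual of `E`. -/
theorem mul_ncard_hermitianInner_ne_zero (hK : Nat.card K = q ^ 2)
    (E : Submodule K (Fin n → K)) {m : ℕ} (hm : Module.finrank K (hermitianDual hK E) = m)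
    {v : Fin n → K} (hv : v ∉ E) :
    (q : ℤ) ^ 2 * {w | w ∈ hermitianDual hK E ∧ ¬ hermitianInner q v w = 0}.ncard =
      (q ^ 2 - 1) * (q : ℤ) ^ (2 * m) := by
  have h2 := congrArg (Nat.cast (R := ℤ))
    (ncard_sep_add_ncard_sep_not (hermitianDual hK E : Set (Fin n → K))
      fun w => hermitianInner q v w = 0)
  have h3 : {w | w ∈ (hermitianDual hK E : Set (Fin n → K)) ∧ hermitianInner q v w = 0} =
      (hermitianDual hK (E ⊔ K ∙ v) : Set (Fin n → K)) := by
    ext w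
    rw [hermitianDual_sup, Set.mem_ofPred_eq, SetLike.mem_coe, SetLike.mem_coe, Submodule.mem_inf,
      mem_hermitianDual_span, hermitianInner_eq_zero_comm hK (x := v)]
  have hE := finrank_add_finrank_hermitianDual hK E
  have hEv := finrank_add_finrank_hermitianDual hK (E ⊔ K ∙ v)
  rw [finrank_sup_span hv] at hEv
  obtain ⟨j, rfl⟩ : ∃ j, m = j + 1 := ⟨Module.finrank K (hermitianDual hK (E ⊔ K ∙ v)), by omega⟩
  have hj : Module.finrank K (hermitianDual hK (E ⊔ K ∙ v)) = j := by omega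
  rw [Nat.cast_add, h3, ncard_submodule hK, ncard_submodule hK, hm, hj] at h2
  simp only [SetLike.mem_coe] at h2
  linear_combination (q : ℤ) ^ 2 * h2

/-- Raising the dimension with fixed hull dimension. Both sides count the pairs `(E, v)` with `v`
anisotropic and orthogonal to `E`, on the right as pairs `(C, v)` with `v ∈ C`, where
`C = E ⊔ ⟨v⟩` and `E = C ∩ v^⊥`. -/
theorem hermitianHullCount_mul_eq (hK : Nat.card K = q ^ 2) {k k' m : ℕ} (ℓ : ℕ)
    (hn : n = k + m) (hk : k' = k + 1) :
    (hermitianHullCount hK n k ℓ : ℤ) *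
        ((q : ℤ) ^ (2 * m) - (-1) ^ (m + ℓ) * (q : ℤ) ^ (m + ℓ)) =
      (hermitianHullCount hK n k' ℓ : ℤ) *
        ((q : ℤ) ^ (2 * k') - (-1) ^ (k' + ℓ) * (q : ℤ) ^ (k' + ℓ)) := by
  have hL := mul_ncard_pairs (c := q)
    (P := {E : Submodule K (Fin n → K) |
      Module.finrank K E = k ∧ Module.finrank K (hermitianHull hK E) = ℓ})
    (S := fun E => {v | v ∈ hermitianDual hK E ∧ ¬ hermitianInner q v v = 0})
    fun E hE => mul_ncard_anisotropic hK (hermitianDual hK E) (d := m) (r := ℓ)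
      (by have := finrank_add_finrank_hermitianDual hK E; have := hE.1; omega)
      (by rw [hermitianHull_hermitianDual, hE.2])
  have hR := mul_ncard_pairs (c := q)
    (P := {C : Submodule K (Fin n → K) |
      Module.finrank K C = k' ∧ Module.finrank K (hermitianHull hK C) = ℓ})
    (S := fun C => {v | v ∈ C ∧ ¬ hermitianInner q v v = 0})
    fun C hC => mul_ncard_anisotropic hK C hC.1 hC.2
  have hb : {p : Submodule K (Fin n → K) × (Fin n → K) |
        p.1 ∈ {E : Submodule K (Fin n → K) |
          Module.finrank K E = k ∧ Module.finrank K (hermitianHull hK E) = ℓ} ∧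
        p.2 ∈ {v | v ∈ hermitianDual hK p.1 ∧ ¬ hermitianInner q v v = 0}}.ncard =
      {p : Submodule K (Fin n → K) × (Fin n → K) |
        p.1 ∈ {C : Submodule K (Fin n → K) |
          Module.finrank K C = k' ∧ Module.finrank K (hermitianHull hK C) = ℓ} ∧
        p.2 ∈ {v | v ∈ p.1 ∧ ¬ hermitianInner q v v = 0}}.ncard := by
    refine Set.ncard_congr (fun p _ => (p.1 ⊔ K ∙ p.2, p.2)) ?_ ?_ ?_
    · rintro ⟨E, v⟩ ⟨⟨hE, hr⟩, hv, hvv⟩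
      refine ⟨⟨?_, ?_⟩, ?_, hvv⟩
      · rw [finrank_sup_span (notMem_of_hermitianInner_ne_zero hK hv hvv), hE, hk]
      · rw [hermitianHull_sup_span_of_anisotropic hK hv hvv, hr]
      · exact Submodule.mem_sup_right (Submodule.mem_span_singleton_self v)
    · rintro ⟨E, v⟩ ⟨E', v'⟩ ⟨-, hv, hvv⟩ ⟨-, hv', hvv'⟩ h
      obtain ⟨h1, rfl⟩ := Prod.ext_iff.1 h
      dsimp only at h1 hv hv' hvv
      rw [← sup_span_inf_hermitianDual_span hK hv hvv, h1,
        sup_span_inf_hermitianDual_span hK hv' hvv]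
    · rintro ⟨C, v⟩ ⟨⟨hC, hr⟩, hv, hvv⟩
      dsimp only at hC hr hv hvv
      have hvE : v ∈ hermitianDual hK (C ⊓ hermitianDual hK (K ∙ v)) :=
        (le_hermitianDual_span hK).1 inf_le_right
      have hCv := inf_hermitianDual_span_sup_span hK hv hvv
      refine ⟨(C ⊓ hermitianDual hK (K ∙ v), v), ⟨⟨?_, ?_⟩, hvE, hvv⟩, Prod.ext hCv rfl⟩
      · have := finrank_sup_span (notMem_of_hermitianInner_ne_zero hK hvE hvv)
        rw [hCv] at this
        dsimp only
        omega
      · rw [← hermitianHull_sup_span_of_anisotropic hK hvE hvv, hCv, hr]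
  rw [hb] at hL
  have hq : ((q : ℤ) - 1) ≠ 0 := by
    have := two_le_of_card_eq_sq hK
    have : (2 : ℤ) ≤ q := by exact_mod_cast this
    omega
  refine mul_left_cancel₀ hq ?_
  unfold hermitianHullCount
  linear_combination hR - hL

/-- Raising both dimensions. Both sides count the triples `(E, v, w)` with `v` and `w` orthogonal
to `E`, `v` isotropic and `⟨v, w⟩_H ≠ 0`, on the right as triples `(C, v, w)` with `v` in the hull
of `C`, where `C = E ⊔ ⟨v⟩` and `E = C ∩ w^⊥`. The vector `w` records the complement `E` of `v`. -/
theorem hermitianHullCount_mul_eq_succ (hK : Nat.card K = q ^ 2) {k k' m : ℕ} (ℓ : ℕ)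
    (hn : n = k + m) (hk : k' = k + 1) :
    (hermitianHullCount hK n k ℓ : ℤ) *
        (((q : ℤ) ^ (2 * m) + (-1) ^ (m + ℓ) * (q : ℤ) ^ (m + ℓ) * (q - 1) - q * q ^ (2 * ℓ)) *
          (q : ℤ) ^ (2 * m)) =
      (hermitianHullCount hK n k' (ℓ + 1) : ℤ) *
        (q * ((q : ℤ) ^ (2 * (ℓ + 1)) - 1) * (q : ℤ) ^ (2 * n)) := by
  have hL := mul_ncard_pairs (c := (q : ℤ) * q ^ 2)
    (M := ((q : ℤ) ^ (2 * m) + (-1) ^ (m + ℓ) * (q : ℤ) ^ (m + ℓ) * (q - 1) - q * q ^ (2 * ℓ)) *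
      ((q ^ 2 - 1) * (q : ℤ) ^ (2 * m)))
    (P := {E : Submodule K (Fin n → K) |
      Module.finrank K E = k ∧ Module.finrank K (hermitianHull hK E) = ℓ})
    (S := fun E => {p : (Fin n → K) × (Fin n → K) |
      p.1 ∈ {v | (v ∈ hermitianDual hK E ∧ hermitianInner q v v = 0) ∧ ¬ v ∈ E} ∧
      p.2 ∈ {w | w ∈ hermitianDual hK E ∧ ¬ hermitianInner q p.1 w = 0}})
    fun E hE => by
      have hm : Module.finrank K (hermitianDual hK E) = m := by
        have := finrank_add_finrank_hermitianDual hK E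
        have := hE.1
        omega
      rw [mul_assoc, mul_ncard_pairs (c := (q : ℤ) ^ 2)
          (S := fun v => {w | w ∈ hermitianDual hK E ∧ ¬ hermitianInner q v w = 0})
          fun v hv => mul_ncard_hermitianInner_ne_zero hK E hm hv.2,
        ← mul_assoc, mul_ncard_isotropic_notMem hK E hm hE.2]
  have hR := mul_ncard_pairs (c := (q : ℤ) ^ 2)
    (M := ((q : ℤ) ^ (2 * (ℓ + 1)) - 1) * ((q ^ 2 - 1) * (q : ℤ) ^ (2 * n)))
    (P := {C : Submodule K (Fin n → K) |
      Module.finrank K C = k' ∧ Module.finrank K (hermitianHull hK C) = ℓ + 1})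
    (S := fun C => {p : (Fin n → K) × (Fin n → K) |
      p.1 ∈ {v | v ∈ hermitianHull hK C ∧ ¬ v ∈ (⊥ : Submodule K (Fin n → K))} ∧
      p.2 ∈ {w | w ∈ hermitianDual hK ⊥ ∧ ¬ hermitianInner q p.1 w = 0}})
    fun C hC => by
      have hm : Module.finrank K (hermitianDual hK (⊥ : Submodule K (Fin n → K))) = n := by
        have := finrank_add_finrank_hermitianDual hK (⊥ : Submodule K (Fin n → K))
        rwa [finrank_bot, zero_add] at this
      rw [mul_ncard_pairs (c := (q : ℤ) ^ 2)
        (S := fun v => {w | w ∈ hermitianDual hK ⊥ ∧ ¬ hermitianInner q v w = 0})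
        fun v hv => mul_ncard_hermitianInner_ne_zero hK ⊥ hm hv.2]
      have h1 := congrArg (Nat.cast (R := ℤ)) (ncard_sep_add_ncard_sep_not
        (hermitianHull hK C : Set (Fin n → K)) fun v => v ∈ (⊥ : Submodule K (Fin n → K)))
      have h2 : {v | v ∈ (hermitianHull hK C : Set (Fin n → K)) ∧
          v ∈ (⊥ : Submodule K (Fin n → K))} = {0} := by
        ext v
        simp only [SetLike.mem_coe, Submodule.mem_bot, Set.mem_ofPred_eq, Set.mem_singleton_iff,
          and_iff_right_iff_imp]
        rintro rfl
        exact Submodule.zero_mem _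
      rw [Nat.cast_add, h2, ncard_submodule hK, hC.2, Set.ncard_singleton] at h1
      simp only [SetLike.mem_coe] at h1
      rw [← h1]
      push_cast
      ring
  have hb : {p : Submodule K (Fin n → K) × (Fin n → K) × (Fin n → K) |
        p.1 ∈ {E : Submodule K (Fin n → K) |
          Module.finrank K E = k ∧ Module.finrank K (hermitianHull hK E) = ℓ} ∧
        p.2 ∈ {r : (Fin n → K) × (Fin n → K) |
          r.1 ∈ {v | (v ∈ hermitianDual hK p.1 ∧ hermitianInner q v v = 0) ∧ ¬ v ∈ p.1} ∧
          r.2 ∈ {w | w ∈ hermitianDual hK p.1 ∧ ¬ hermitianInner q r.1 w = 0}}}.ncard =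
      {p : Submodule K (Fin n → K) × (Fin n → K) × (Fin n → K) |
        p.1 ∈ {C : Submodule K (Fin n → K) |
          Module.finrank K C = k' ∧ Module.finrank K (hermitianHull hK C) = ℓ + 1} ∧
        p.2 ∈ {r : (Fin n → K) × (Fin n → K) |
          r.1 ∈ {v | v ∈ hermitianHull hK p.1 ∧ ¬ v ∈ (⊥ : Submodule K (Fin n → K))} ∧
          r.2 ∈ {w | w ∈ hermitianDual hK ⊥ ∧ ¬ hermitianInner q r.1 w = 0}}}.ncard := by
    refine Set.ncard_congr (fun p _ => (p.1 ⊔ K ∙ p.2.1, p.2)) ?_ ?_ ?_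
    · rintro ⟨E, v, w⟩ ⟨⟨hE, hr⟩, ⟨⟨hv, hvv⟩, hvE⟩, hw, hvw⟩
      dsimp only at hE hr hv hvv hvE hw hvw
      have hull := hermitianHull_sup_span_of_isotropic hK hv hvv
      refine ⟨⟨?_, ?_⟩, ⟨?_, ?_⟩, ?_, hvw⟩
      · rw [finrank_sup_span hvE, hE, hk]
      · rw [hull, finrank_sup_span (E := hermitianHull hK E) fun h => hvE h.1, hr]
      · dsimp only
        rw [hull]
        exact Submodule.mem_sup_right (Submodule.mem_span_singleton_self v)
      · intro h
        have hv0 : v = 0 := (Submodule.mem_bot K).1 h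
        exact hvE (hv0 ▸ E.zero_mem)
      · intro x hx
        rw [(Submodule.mem_bot K).1 hx, hermitianInner_zero_left]
    · rintro ⟨E, v, w⟩ ⟨E', v', w'⟩ ⟨-, -, hw, hvw⟩ ⟨-, -, hw', hvw'⟩ h
      obtain ⟨h1, h2⟩ := Prod.ext_iff.1 h
      obtain ⟨rfl, rfl⟩ := Prod.ext_iff.1 h2
      dsimp only at h1 hw hw' hvw
      rw [← sup_span_inf_hermitianDual_span hK hw hvw, h1,
        sup_span_inf_hermitianDual_span hK hw' hvw]
    · rintro ⟨C, v, w⟩ ⟨⟨hC, hr⟩, ⟨hv, hv0⟩, -, hvw⟩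
      dsimp only at hC hr hv hv0 hvw
      set E := C ⊓ hermitianDual hK (K ∙ w)
      have hwE : w ∈ hermitianDual hK E := (le_hermitianDual_span hK).1 inf_le_right
      have hCv : E ⊔ K ∙ v = C := inf_hermitianDual_span_sup_span hK hv.1 hvw
      have hvE : v ∉ E := notMem_of_hermitianInner_ne_zero hK hwE hvw
      have hvd : v ∈ hermitianDual hK E := fun x hx => hv.2 x hx.1
      have hvv : hermitianInner q v v = 0 := hv.2 v hv.1
      refine ⟨(E, v, w), ⟨⟨?_, ?_⟩, ⟨⟨hvd, hvv⟩, hvE⟩, hwE, hvw⟩, Prod.ext hCv rfl⟩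
      · have := finrank_sup_span hvE
        rw [hCv] at this
        dsimp only
        omega
      · have := hermitianHull_sup_span_of_isotropic hK hvd hvv
        have h2 := finrank_sup_span (E := hermitianHull hK E) (v := v) fun h => hvE h.1
        rw [← this, hCv] at h2
        dsimp only
        omega
  rw [hb] at hL
  have hq : ((q : ℤ) ^ 2 - 1) ≠ 0 := by
    have := two_le_of_card_eq_sq hK
    have : (2 : ℤ) ≤ q := by exact_mod_cast this
    nlinarith
  refine mul_left_cancel₀ hq ?_
  unfold hermitianHullCount
  linear_combination (q : ℤ) * hR - hL

/-! ### The ratio of consecutive counts -/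

/-- The exact ratio of consecutive counts in product form, with `a + 1` and `b + 1` for the two
positive parameters: eliminate the number of codes of dimension `a + ℓ` and hull dimension `ℓ`
from the two recursions. -/
theorem hermitianHullCount_ratio (hK : Nat.card K = q ^ 2) (a b ℓ : ℕ) :
    (hermitianHullCount hK ((a + 1) + (b + 1) + 2 * ℓ) ((a + 1) + ℓ) (ℓ + 1) : ℤ) *
        ((q : ℤ) ^ (a + b + 1) * ((q : ℤ) ^ (2 * (ℓ + 1)) - 1)) =
      (hermitianHullCount hK ((a + 1) + (b + 1) + 2 * ℓ) ((a + 1) + ℓ) ℓ : ℤ) *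
        (((q : ℤ) ^ (a + 1) - (-1) ^ (a + 1)) * ((q : ℤ) ^ (b + 1) - (-1) ^ (b + 1))) := by
  have h1 := hermitianHullCount_mul_eq (n := (a + 1) + (b + 1) + 2 * ℓ) (k := a + ℓ)
    (k' := a + 1 + ℓ) (m := b + 2 + ℓ) hK ℓ (by omega) (by omega)
  have h2 := hermitianHullCount_mul_eq_succ (n := (a + 1) + (b + 1) + 2 * ℓ) (k := a + ℓ)
    (k' := a + 1 + ℓ) (m := b + 2 + ℓ) hK ℓ (by omega) (by omega)
  have e1 : (-1 : ℤ) ^ (b + 2 + ℓ + ℓ) = (-1) ^ b := by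
    rw [show b + 2 + ℓ + ℓ = b + 2 * (1 + ℓ) by ring, pow_add, (even_two_mul _).neg_one_pow,
      mul_one]
  have e2 : (-1 : ℤ) ^ (a + 1 + ℓ + ℓ) = -(-1) ^ a := by
    rw [show a + 1 + ℓ + ℓ = a + 1 + 2 * ℓ by ring, pow_add, (even_two_mul _).neg_one_pow]
    ring
  have hβ : ((-1 : ℤ) ^ b) ^ 2 = 1 := by
    rw [← pow_mul, (Even.mul_left even_two b).neg_one_pow]
  rw [e1] at h1 h2
  rw [e2] at h1
  have hq : (q : ℤ) ≠ 0 := by exact_mod_cast ne_zero_of_card_eq_sq hK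
  generalize (hermitianHullCount hK (a + 1 + (b + 1) + 2 * ℓ) (a + ℓ) ℓ : ℤ) = X at h1 h2
  generalize (hermitianHullCount hK (a + 1 + (b + 1) + 2 * ℓ) (a + 1 + ℓ) ℓ : ℤ) = A at h1 ⊢
  generalize (hermitianHullCount hK (a + 1 + (b + 1) + 2 * ℓ) (a + 1 + ℓ) (ℓ + 1) : ℤ) = A' at *
  generalize hα : (-1 : ℤ) ^ a = α at *
  generalize hβ' : (-1 : ℤ) ^ b = β at *
  have ep : ∀ j, (q : ℤ) ^ j ≠ 0 := fun j => pow_ne_zero j hq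
  have ha := ep a
  have hb := ep b
  have hl := ep ℓ
  simp only [pow_add, pow_mul', mul_add, pow_one, mul_one, hα, hβ'] at h1 h2 ⊢
  generalize (q : ℤ) ^ a = s at *
  generalize (q : ℤ) ^ b = t at *
  generalize (q : ℤ) ^ ℓ = u at *
  generalize (q : ℤ) = Q at *
  -- The two recursions with common powers of `q` cancelled, where `s = q ^ a` and `t = q ^ b`.
  have h1' : X * (t * Q * (t * Q ^ 2 - β)) = A * (s * (s * Q + α)) := by
    refine mul_left_cancel₀ (mul_ne_zero (pow_ne_zero 2 hl) hq) ?_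
    linear_combination h1
  have h2' : X * ((t * Q ^ 2 - β) * (t * Q + β)) = A' * ((u ^ 2 * Q ^ 2 - 1) * s ^ 2) := by
    refine mul_left_cancel₀
      (mul_ne_zero (mul_ne_zero (pow_ne_zero 4 hl) (pow_ne_zero 2 hb)) (pow_ne_zero 5 hq)) ?_
    linear_combination h2 - X * u ^ 4 * t ^ 2 * Q ^ 5 * hβ
  refine mul_left_cancel₀ ha ?_
  linear_combination (t * Q + β) * h1' - t * Q * h2'

/-- There is a code for each pair of admissible dimensions. -/
theorem hermitianHullCount_pos (hK : Nat.card K = q ^ 2) (a b ℓ : ℕ) :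
    0 < hermitianHullCount hK (a + b + 2 * ℓ) (a + ℓ) ℓ := by
  have hq2 : (2 : ℤ) ≤ q := by exact_mod_cast two_le_of_card_eq_sq hK
  have hq0 : (0 : ℤ) < q := by omega
  induction a generalizing b with
  | zero =>
    induction ℓ generalizing b with
    | zero =>
      refine (Set.ncard_pos (Set.toFinite _)).2 ⟨⊥, by simp, ?_⟩
      have h0 : hermitianHull hK (⊥ : Submodule K (Fin (0 + b + 2 * 0) → K)) = ⊥ := bot_inf_eq _
      rw [h0, finrank_bot]
    | succ ℓ ih =>
      have hX := ih (b + 2)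
      rw [show 0 + (b + 2) + 2 * ℓ = 0 + b + 2 * (ℓ + 1) by ring] at hX
      have h := hermitianHullCount_mul_eq_succ (n := 0 + b + 2 * (ℓ + 1)) (k := 0 + ℓ)
        (k' := 0 + (ℓ + 1)) (m := b + 2 + ℓ) hK ℓ (by omega) (by omega)
      by_contra hA
      rw [Nat.eq_zero_of_not_pos hA, Nat.cast_zero, zero_mul] at h
      refine (mul_pos (Nat.cast_pos.2 hX) (mul_pos ?_ (pow_pos hq0 _))).ne' h
      have hb : (q : ℤ) < q ^ (b + 2) := by
        calc (q : ℤ) < q ^ 2 := by nlinarith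
          _ ≤ q ^ (b + 2) := pow_le_pow_right₀ (by omega) (by omega)
      rw [show b + 2 + ℓ + ℓ = b + 2 + 2 * ℓ by ring, pow_add, pow_add _ _ (2 * ℓ),
        (even_two_mul ℓ).neg_one_pow, show 2 * (b + 2 + ℓ) = (b + 2) * 2 + 2 * ℓ by ring,
        pow_add _ ((b + 2) * 2), pow_mul]
      have hu := pow_pos hq0 (2 * ℓ)
      generalize (q : ℤ) ^ (b + 2) = s at *
      -- The first factor is `q ^ (2 * ℓ) * (s - ε) * (s + ε * q)` with `s = q ^ (b + 2)`, `ε = ±1`.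
      rcases neg_one_pow_eq_or ℤ (b + 2) with h' | h' <;> rw [h']
      · have := mul_pos hu (mul_pos (show 0 < s - 1 by omega) (show 0 < s + q by omega))
        linarith
      · have := mul_pos hu (mul_pos (show 0 < s + 1 by omega) (show 0 < s - q by omega))
        linarith
  | succ a ih =>
    have hX := ih (b + 1)
    rw [show a + (b + 1) + 2 * ℓ = a + 1 + b + 2 * ℓ by ring] at hX
    have h := hermitianHullCount_mul_eq (n := a + 1 + b + 2 * ℓ) (k := a + ℓ)
      (k' := a + 1 + ℓ) (m := b + 1 + ℓ) hK ℓ (by omega) (by omega)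
    by_contra hA
    rw [Nat.eq_zero_of_not_pos hA, Nat.cast_zero, zero_mul] at h
    refine (mul_pos (Nat.cast_pos.2 hX) ?_).ne' h
    have hlt : (q : ℤ) ^ (b + 1 + ℓ + ℓ) < q ^ (2 * (b + 1 + ℓ)) :=
      pow_lt_pow_right₀ (by omega) (by omega)
    have hpos := pow_pos hq0 (b + 1 + ℓ + ℓ)
    rcases neg_one_pow_eq_or ℤ (b + 1 + ℓ + ℓ) with h' | h' <;> rw [h'] <;> linarith

end Recursion

/-! ### Limits -/

section Limits

variable {K : Type*} [Field K] [Finite K] {q : ℕ}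

theorem two_le_cast_of_card_eq_sq (hK : Nat.card K = q ^ 2) : (2 : ℝ) ≤ q := by
  exact_mod_cast two_le_of_card_eq_sq hK

theorem pow_sub_neg_one_pow_pos {x : ℝ} (hx : 2 ≤ x) {m : ℕ} (hm : m ≠ 0) :
    0 < x ^ m - (-1) ^ m := by
  have h1 : 1 < x ^ m := one_lt_pow₀ (by linarith) hm
  rcases neg_one_pow_eq_or ℝ m with h | h <;> rw [h] <;> linarith

theorem tendsto_pow_div_pow_sub_neg_one_pow {x : ℝ} (hx : 2 ≤ x) :
    Tendsto (fun m : ℕ => x ^ m / (x ^ m - (-1) ^ m)) atTop (𝓝 1) := by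
  have hx0 : 0 < x := by linarith
  have h1 : Tendsto (fun m : ℕ => (-1 / x) ^ m) atTop (𝓝 0) := by
    refine tendsto_pow_atTop_nhds_zero_of_abs_lt_one ?_
    rw [abs_div, abs_neg, abs_one, abs_of_pos hx0, div_lt_one hx0]
    linarith
  have h2 : Tendsto (fun m : ℕ => (1 - (-1 / x) ^ m)⁻¹) atTop (𝓝 1) := by
    simpa using (tendsto_const_nhds.sub h1).inv₀ (by norm_num : (1 : ℝ) - 0 ≠ 0)
  refine h2.congr fun m => ?_
  have := pow_pos hx0 m
  rw [div_pow, one_sub_div this.ne', inv_div]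

/-- The exact ratio of consecutive counts, with its dependence on `a` and `b` separated. -/
theorem hermitianHullCount_div (hK : Nat.card K = q ^ 2) (ℓ : ℕ) {a b : ℕ} (ha : a ≠ 0)
    (hb : b ≠ 0) :
    (hermitianHullCount hK (a + b + 2 * ℓ) (a + ℓ) ℓ : ℝ) /
        (hermitianHullCount hK (a + b + 2 * ℓ) (a + ℓ) (ℓ + 1) : ℝ) =
      ((q : ℝ) ^ (2 * (ℓ + 1)) - 1) / q * ((q : ℝ) ^ a / ((q : ℝ) ^ a - (-1) ^ a)) *
        ((q : ℝ) ^ b / ((q : ℝ) ^ b - (-1) ^ b)) := by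
  have hq := two_le_cast_of_card_eq_sq hK
  have hda := pow_sub_neg_one_pow_pos hq ha
  have hdb := pow_sub_neg_one_pow_pos hq hb
  have hpos := hermitianHullCount_pos hK a b ℓ
  obtain ⟨a, rfl⟩ := Nat.exists_eq_succ_of_ne_zero ha
  obtain ⟨b, rfl⟩ := Nat.exists_eq_succ_of_ne_zero hb
  simp only [Nat.succ_eq_add_one] at *
  have h := congrArg (Int.cast (R := ℝ)) (hermitianHullCount_ratio hK a b ℓ)
  push_cast at h
  have hA : (0 : ℝ) < hermitianHullCount hK (a + 1 + (b + 1) + 2 * ℓ) (a + 1 + ℓ) ℓ := by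
    exact_mod_cast hpos
  have hA' : (hermitianHullCount hK (a + 1 + (b + 1) + 2 * ℓ) (a + 1 + ℓ) (ℓ + 1) : ℝ) ≠ 0 := by
    intro h0
    rw [h0, zero_mul] at h
    exact (mul_pos hA (mul_pos hda hdb)).ne h
  rw [div_mul_div_comm, div_mul_div_comm, div_eq_div_iff hA' (by positivity)]
  rw [pow_add _ (a + b), pow_add _ a b] at h
  rw [pow_succ _ a, pow_succ _ b] at *
  linear_combination (-(q : ℝ)) * h

theorem tendsto_hermitianHullCount_div (hK : Nat.card K = q ^ 2) (ℓ : ℕ) :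
    Tendsto (fun ab : ℕ × ℕ =>
        (hermitianHullCount hK (ab.1 + ab.2 + 2 * ℓ) (ab.1 + ℓ) ℓ : ℝ) /
          (hermitianHullCount hK (ab.1 + ab.2 + 2 * ℓ) (ab.1 + ℓ) (ℓ + 1) : ℝ))
      (atTop ×ˢ atTop) (𝓝 (((q : ℝ) ^ (2 * (ℓ + 1)) - 1) / q)) := by
  have h := tendsto_pow_div_pow_sub_neg_one_pow (two_le_cast_of_card_eq_sq hK)
  have h1 := (h.comp (tendsto_fst (f := atTop (α := ℕ)) (g := atTop (α := ℕ)))).const_mul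
    (((q : ℝ) ^ (2 * (ℓ + 1)) - 1) / q) |>.mul
      (h.comp (tendsto_snd (f := atTop (α := ℕ)) (g := atTop (α := ℕ))))
  rw [mul_one, mul_one] at h1
  refine h1.congr' ?_
  filter_upwards [(eventually_ne_atTop 0).prod_mk (eventually_ne_atTop 0)] with ab hab
  exact (hermitianHullCount_div hK ℓ hab.1 hab.2).symm

end Limits

theorem corollary3p5 :
    -- statements for a fixed prime power `q` and the field `K` with `q ^ 2` elements
    (∀ (q : ℕ), IsPrimePow q →
      ∀ (K : Type*) [Field K] [Finite K] (hK : Nat.card K = q ^ 2),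
      -- (1) `a = k - ℓ ≥ 1` fixed, `b = n - k - ℓ → ∞`
      (∀ ℓ a : ℕ, 1 ≤ a →
        Tendsto (fun b : ℕ =>
            (hermitianHullCount hK (a + b + 2 * ℓ) (a + ℓ) ℓ : ℝ) /
              (hermitianHullCount hK (a + b + 2 * ℓ) (a + ℓ) (ℓ + 1) : ℝ))
          atTop
          (𝓝 ((q : ℝ) ^ (a - 1) * ((q : ℝ) ^ (ℓ + 1) + 1) * ((q : ℝ) ^ (ℓ + 1) - 1) /
            ((q : ℝ) ^ a - (-1) ^ a)))) ∧
      -- (2) `a, b → ∞` jointly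
      (∀ ℓ : ℕ,
        Tendsto (fun ab : ℕ × ℕ =>
            (hermitianHullCount hK (ab.1 + ab.2 + 2 * ℓ) (ab.1 + ℓ) ℓ : ℝ) /
              (hermitianHullCount hK (ab.1 + ab.2 + 2 * ℓ) (ab.1 + ℓ) (ℓ + 1) : ℝ))
          (atTop ×ˢ atTop)
          (𝓝 (((q : ℝ) ^ (2 * (ℓ + 1)) - 1) / q))) ∧
      -- (3) the limit in (2) is minimal exactly at `ℓ = 0`, with value `q - 1 / q > 1`
      (∀ ℓ : ℕ, ℓ ≠ 0 →
        ((q : ℝ) ^ (2 * (0 + 1)) - 1) / q < ((q : ℝ) ^ (2 * (ℓ + 1)) - 1) / q) ∧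
      ((q : ℝ) ^ (2 * (0 + 1)) - 1) / q = (q : ℝ) - (q : ℝ)⁻¹ ∧
      1 < (q : ℝ) - (q : ℝ)⁻¹ ∧
      -- consequently the counts decrease asymptotically in the joint regime
      (∀ ℓ : ℕ, ∀ᶠ ab : ℕ × ℕ in atTop ×ˢ atTop,
        hermitianHullCount hK (ab.1 + ab.2 + 2 * ℓ) (ab.1 + ℓ) (ℓ + 1) <
          hermitianHullCount hK (ab.1 + ab.2 + 2 * ℓ) (ab.1 + ℓ) ℓ)) ∧
    -- the minimal value is `3 / 2` at `q = 2` and grows like `q`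
    (2 : ℝ) - (2 : ℝ)⁻¹ = 3 / 2 ∧
    Asymptotics.IsEquivalent atTop (fun q : ℕ => (q : ℝ) - (q : ℝ)⁻¹) (fun q : ℕ => (q : ℝ)) := by
  refine ⟨fun q _ K _ _ hK => ?_, by norm_num, ?_⟩
  · have hq := two_le_cast_of_card_eq_sq hK
    have hq0 : (0 : ℝ) < q := by linarith
    have hlt : ∀ ℓ : ℕ, ℓ ≠ 0 →
        ((q : ℝ) ^ (2 * (0 + 1)) - 1) / q < ((q : ℝ) ^ (2 * (ℓ + 1)) - 1) / q := fun ℓ hℓ =>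
      div_lt_div_of_pos_right
        (sub_lt_sub_right (pow_lt_pow_right₀ (by linarith) (by omega)) 1) hq0
    have hval : ((q : ℝ) ^ (2 * (0 + 1)) - 1) / q = (q : ℝ) - (q : ℝ)⁻¹ := by
      field_simp
    have hone : 1 < (q : ℝ) - (q : ℝ)⁻¹ := by
      have : (q : ℝ)⁻¹ < 1 := inv_lt_one_of_one_lt₀ (by linarith)
      linarith
    refine ⟨fun ℓ a ha => ?_, tendsto_hermitianHullCount_div hK, hlt, hval, hone, fun ℓ => ?_⟩
    · have h := (tendsto_pow_div_pow_sub_neg_one_pow hq).const_mul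
        (((q : ℝ) ^ (2 * (ℓ + 1)) - 1) / q * ((q : ℝ) ^ a / ((q : ℝ) ^ a - (-1) ^ a)))
      have hd := pow_sub_neg_one_pow_pos hq (m := a) (by omega)
      have he : ((q : ℝ) ^ (2 * (ℓ + 1)) - 1) / q * ((q : ℝ) ^ a / ((q : ℝ) ^ a - (-1) ^ a)) * 1 =
          (q : ℝ) ^ (a - 1) * ((q : ℝ) ^ (ℓ + 1) + 1) * ((q : ℝ) ^ (ℓ + 1) - 1) /
            ((q : ℝ) ^ a - (-1) ^ a) := by
        obtain ⟨m, rfl⟩ : ∃ m, a = m + 1 := ⟨a - 1, by omega⟩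
        rw [Nat.add_sub_cancel, mul_one, div_mul_div_comm,
          div_eq_div_iff (mul_pos hq0 hd).ne' hd.ne']
        ring
      rw [he] at h
      refine h.congr' ?_
      filter_upwards [eventually_ne_atTop 0] with b hb
      exact (hermitianHullCount_div hK ℓ (by omega) hb).symm
    · have h1 : 1 < ((q : ℝ) ^ (2 * (ℓ + 1)) - 1) / q := by
        rcases eq_or_ne ℓ 0 with rfl | hℓ
        · rwa [hval]
        · exact (hone.trans_eq hval.symm).trans (hlt ℓ hℓ)
      filter_upwards [(tendsto_hermitianHullCount_div hK ℓ).eventually_const_lt h1] with ab hab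
      rcases Nat.eq_zero_or_pos
        (hermitianHullCount hK (ab.1 + ab.2 + 2 * ℓ) (ab.1 + ℓ) (ℓ + 1)) with h0 | h0
      · rw [h0]
        exact hermitianHullCount_pos hK ab.1 ab.2 ℓ
      · rw [one_lt_div (Nat.cast_pos.2 h0)] at hab
        exact_mod_cast hab
  · rw [Asymptotics.IsEquivalent]
    have h2 : ((fun q : ℕ => (q : ℝ) - (q : ℝ)⁻¹) - fun q : ℕ => (q : ℝ)) =
        fun q : ℕ => -((q : ℝ)⁻¹) := by
      funext q
      exact sub_sub_cancel_left _ _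
    rw [h2]
    refine Asymptotics.IsLittleO.neg_left ?_
    refine (tendsto_inv_atTop_nhds_zero_nat (𝕜 := ℝ)).isBigO_one ℝ |>.trans_isLittleO ?_
    exact Asymptotics.isLittleO_const_left.2 (Or.inr
      (tendsto_norm_atTop_atTop.comp tendsto_natCast_atTop_atTop))
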